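/- For every positive integer $p$, let $$J_p=\sum_{j=1}^{p-1} j\cot\left(\frac{j\pi}{p}\right)$$ (the empty sum being $0$). Then the series $$C_p=\sum_{n=1}^{\infty}\left(H_{pn}-\ln(pn)-\gamma-\frac{1}{2pn}\right)$$ converges, where $H_n=\sum_{k=1}^n \frac1k$ and $\gamma$ is Euler's constant, and $$\pi J_p=-p^2\ln p+(\ln(2\pi)-\gamma)p^2-p+2p^2C_p.$$ -/

import Mathlib

/-- The sum of cotangents `J_p = ∑_{j=1}^{p-1} j cot (j π / p)`, an empty sum being `0`. -/
noncomputable def cotSum (p : ℕ) : ℝ :=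
  ∑ j ∈ Finset.Icc 1 (p - 1), (j : ℝ) * Real.cot ((j : ℝ) * Real.pi / (p : ℝ))

/-- The sequence `c_n = H_n - ln n - γ - 1 / (2 n)`, used for `n ≥ 1`. -/
noncomputable def harmonicRemainder (n : ℕ) : ℝ :=
  (harmonic n : ℝ) - Real.log (n : ℝ) - Real.eulerMascheroniConstant - 1 / (2 * (n : ℝ))

/-- The sum of the series `C_p = ∑_{n ≥ 1} c_{p n}`; the series is indexed by `n + 1` with
`n` a natural number. -/
noncomputable def harmonicRemainderSum (p : ℕ) : ℝ :=
  ∑' n : ℕ, harmonicRemainder (p * (n + 1))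

open Filter Topology Finset

/-! Expand `π cot (π j / p)` in partial fractions, multiply by `j` and sum over `j` first.
Reflecting `j ↦ p - j` in the second fraction turns the `n`-th block into `2n + 1` times an
increment of `H_{pn}` plus elementary terms (`sum_mul_one_div_sub`). Abel summation then yields the
sum of `H_{pn}`, that is `C_p` plus `log N!`, and Stirling supplies `log (2π)`. The bound `|c_n| ≤ 1
/ n²` gives convergence and kills the boundary term. -/

lemma harmonicRemainder_succ_sub {n : ℕ} (hn : 0 < n) :
    harmonicRemainder (n + 1) - harmonicRemainder n =
      (1 / (n : ℝ) + 1 / ((n : ℝ) + 1)) / 2 - Real.log (1 + 1 / (n : ℝ)) := by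
  have hn' : (0 : ℝ) < n := by exact_mod_cast hn
  have h : 1 + 1 / (n : ℝ) = ((n : ℝ) + 1) / n := by field_simp
  rw [h, Real.log_div (by positivity) (by positivity)]
  simp only [harmonicRemainder, harmonic_succ]
  push_cast
  field_simp
  ring

/-- This is `u ≤ sinh u` at `u = log (1 + 1 / x)`. -/
lemma log_one_add_inv_le {x : ℝ} (hx : 0 < x) :
    Real.log (1 + 1 / x) ≤ (1 / x + 1 / (x + 1)) / 2 := by
  have h1 : 0 ≤ Real.log (1 + 1 / x) := Real.log_nonneg (by simp [hx.le])
  have h2 := Real.self_le_sinh_iff.2 h1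
  rw [Real.sinh_log (by positivity)] at h2
  refine h2.trans_eq ?_
  field_simp
  ring

/-- The error term is chosen to telescope, so that `c_n + 1 / n²` is decreasing. -/
lemma le_log_one_add_inv {x : ℝ} (hx : 0 < x) :
    (1 / x + 1 / (x + 1)) / 2 - (1 / x ^ 2 - 1 / (x + 1) ^ 2) ≤ Real.log (1 + 1 / x) := by
  refine le_trans ?_ (Real.le_log_one_add_of_nonneg (by positivity : 0 ≤ 1 / x))
  have h : 2 * (1 / x) / (1 / x + 2) - ((1 / x + 1 / (x + 1)) / 2 - (1 / x ^ 2 - 1 / (x + 1) ^ 2))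
      = (7 * x ^ 2 + 7 * x + 2) / (2 * x ^ 2 * (x + 1) ^ 2 * (2 * x + 1)) := by
    field_simp
    ring
  have : 0 ≤ (7 * x ^ 2 + 7 * x + 2) / (2 * x ^ 2 * (x + 1) ^ 2 * (2 * x + 1)) := by positivity
  linarith

lemma tendsto_harmonicRemainder : Tendsto harmonicRemainder atTop (𝓝 0) := by
  have h1 := Real.tendsto_harmonic_sub_log.sub_const Real.eulerMascheroniConstant
  have h2 := (tendsto_one_div_atTop_nhds_zero_nat (𝕜 := ℝ)).const_mul (1 / 2 : ℝ)
  have h3 := h1.sub h2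
  rw [sub_self, mul_zero, sub_zero] at h3
  refine h3.congr fun n => ?_
  rw [harmonicRemainder, one_div_mul_one_div]

lemma harmonicRemainder_nonpos {n : ℕ} (hn : 0 < n) : harmonicRemainder n ≤ 0 := by
  have hmono : Monotone fun k => harmonicRemainder (k + n) := by
    refine monotone_nat_of_le_succ fun k => ?_
    have h1 := harmonicRemainder_succ_sub (n := k + n) (by omega)
    have h2 := log_one_add_inv_le (x := ((k + n : ℕ) : ℝ)) (by exact_mod_cast (by omega))
    rw [show k + 1 + n = k + n + 1 by ring]
    linarith
  simpa using hmono.ge_of_tendsto ((tendsto_add_atTop_iff_nat n).2 tendsto_harmonicRemainder) 0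

lemma neg_one_div_sq_le_harmonicRemainder {n : ℕ} (hn : 0 < n) :
    -(1 / (n : ℝ) ^ 2) ≤ harmonicRemainder n := by
  have hanti : Antitone fun k => harmonicRemainder (k + n) + 1 / ((k + n : ℕ) : ℝ) ^ 2 := by
    refine antitone_nat_of_succ_le fun k => ?_
    have h1 := harmonicRemainder_succ_sub (n := k + n) (by omega)
    have h2 := le_log_one_add_inv (x := ((k + n : ℕ) : ℝ)) (by exact_mod_cast (by omega))
    rw [show k + 1 + n = k + n + 1 by ring, Nat.cast_succ (k + n)]
    linarith
  have hsq : Tendsto (fun k : ℕ => 1 / (k : ℝ) ^ 2) atTop (𝓝 0) := by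
    simpa using (tendsto_one_div_atTop_nhds_zero_nat (𝕜 := ℝ)).pow 2
  have hlim := tendsto_harmonicRemainder.add hsq
  rw [add_zero] at hlim
  have := hanti.le_of_tendsto ((tendsto_add_atTop_iff_nat n).2 hlim) 0
  simp only [zero_add] at this
  linarith

lemma abs_harmonicRemainder_le {n : ℕ} (hn : 0 < n) :
    |harmonicRemainder n| ≤ 1 / (n : ℝ) ^ 2 := by
  rw [abs_le]
  exact ⟨neg_one_div_sq_le_harmonicRemainder hn,
    (harmonicRemainder_nonpos hn).trans (by positivity)⟩

lemma summable_harmonicRemainder_mul {p : ℕ} (hp : 0 < p) :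
    Summable fun n : ℕ => harmonicRemainder (p * (n + 1)) := by
  have hs : Summable fun n : ℕ => 1 / ((n + 1 : ℕ) : ℝ) ^ 2 :=
    (summable_nat_add_iff 1).2 (Real.summable_one_div_nat_pow.2 one_lt_two)
  refine Summable.of_norm_bounded hs fun n => ?_
  refine (abs_harmonicRemainder_le (by positivity)).trans ?_
  have : n + 1 ≤ p * (n + 1) := Nat.le_mul_of_pos_left _ hp
  gcongr

lemma tendsto_sum_pi_mul_cot {x : ℝ} (h0 : 0 < x) (h1 : x < 1) :
    Tendsto (fun N : ℕ => ∑ n ∈ range N, (1 / ((n : ℝ) + x) - 1 / ((n : ℝ) + 1 - x))) atTop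
      (𝓝 (Real.pi * Real.cot (Real.pi * x))) := by
  have hx : (x : ℂ) ∈ Complex.integerComplement := by
    rw [Complex.mem_integerComplement_iff]
    rintro ⟨m, hm⟩
    have hm' : (m : ℝ) = x := by exact_mod_cast hm
    rw [← hm'] at h0 h1
    have : 0 < m := by exact_mod_cast h0
    have : m < 1 := by exact_mod_cast h1
    omega
  have hc : Tendsto (fun N : ℕ => ∑ n ∈ range N, (1 / (x - (n + 1)) + 1 / (x + ((n : ℝ) + 1))))
      atTop (𝓝 (Real.pi * Real.cot (Real.pi * x) - 1 / x)) := by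
    have := (Complex.continuous_re.tendsto _).comp (tendsto_logDeriv_euler_cot_sub hx)
    convert this using 1
    · ext N
      simp only [Function.comp, cotTerm]
      rw [← Complex.ofReal_re (∑ n ∈ range N, _)]
      push_cast
      rfl
    · rw [← Complex.ofReal_re (Real.pi * Real.cot (Real.pi * x) - 1 / x)]
      push_cast
      rfl
  -- Pairing `n + x` with `n + 1 - x`, instead of the poles `±(n + 1)`, shifts one family by one
  -- index and leaves this term over.
  have ht : Tendsto (fun N : ℕ => 1 / ((N : ℝ) + x)) atTop (𝓝 0) :=
    tendsto_const_nhds.div_atTop (tendsto_atTop_add_const_right _ _ tendsto_natCast_atTop_atTop)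
  have key := (hc.add_const (1 / x)).sub ht
  rw [sub_add_cancel, sub_zero] at key
  refine key.congr fun N => ?_
  induction N with
  | zero => simp
  | succ N ih =>
    rw [sum_range_succ, sum_range_succ, ← ih]
    have e : 1 / (x - ((N : ℝ) + 1)) = -(1 / ((N : ℝ) + 1 - x)) := by
      rw [← neg_sub, one_div_neg_eq_neg_one_div]
    rw [e]
    push_cast
    rw [add_comm x ((N : ℝ) + 1)]
    ring

lemma harmonic_add (a m : ℕ) :
    (harmonic (a + m) : ℝ) = harmonic a + ∑ j ∈ Ico 1 (m + 1), 1 / ((a : ℝ) + j) := by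
  induction m with
  | zero => simp
  | succ m ih =>
    rw [sum_Ico_succ_top (by omega), ← add_assoc a, harmonic_succ]
    push_cast
    rw [ih]
    ring

lemma harmonic_mul_succ {p : ℕ} (hp : 0 < p) (n : ℕ) :
    (harmonic (p * (n + 1)) : ℝ) =
      harmonic (p * n) + ∑ j ∈ Ico 1 p, 1 / ((p : ℝ) * n + j) + 1 / (p * ((n : ℝ) + 1)) := by
  rw [mul_add_one, harmonic_add, sum_Ico_succ_top (by omega)]
  push_cast
  rw [mul_add_one]
  ring

lemma sum_mul_one_div_sub {p : ℕ} (hp : 0 < p) (n : ℕ) :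
    ∑ j ∈ Ico 1 p, (j : ℝ) * (1 / ((p : ℝ) * n + j) - 1 / (p * ((n : ℝ) + 1) - j)) =
      2 * p - 1 / ((n : ℝ) + 1) -
        p * (2 * n + 1) * (harmonic (p * (n + 1)) - harmonic (p * n)) := by
  have hp' : (0 : ℝ) < p := by exact_mod_cast hp
  have hrefl : ∑ j ∈ Ico 1 p, (j : ℝ) * (1 / (p * ((n : ℝ) + 1) - j)) =
      ∑ j ∈ Ico 1 p, ((p : ℝ) - j) * (1 / ((p : ℝ) * n + j)) := by
    have := sum_Ico_reflect (fun j : ℕ => ((p : ℝ) - j) * (1 / ((p : ℝ) * n + j))) 1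
      (Nat.le_succ p)
    rw [Nat.add_sub_cancel, Nat.add_sub_cancel_left] at this
    rw [← this]
    refine sum_congr rfl fun j hj => ?_
    rw [mem_Ico] at hj
    rw [Nat.cast_sub hj.2.le]
    congr 2 <;> ring
  have hsum : ∑ j ∈ Ico 1 p, (j : ℝ) * (1 / ((p : ℝ) * n + j) - 1 / (p * ((n : ℝ) + 1) - j)) =
      ∑ j ∈ Ico 1 p, (2 - p * (2 * n + 1) * (1 / ((p : ℝ) * n + j))) := by
    simp_rw [mul_sub]
    rw [sum_sub_distrib, hrefl, ← sum_sub_distrib]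
    refine sum_congr rfl fun j hj => ?_
    rw [mem_Ico] at hj
    have : (0 : ℝ) < j := by exact_mod_cast hj.1
    field_simp
    ring
  rw [hsum, sum_sub_distrib, ← mul_sum, harmonic_mul_succ hp, sum_const, Nat.card_Ico,
    nsmul_eq_mul, Nat.cast_sub hp]
  push_cast
  field_simp
  ring

/-- Abel summation: the weights `2n + 1` have constant difference 2. -/
lemma sum_odd_mul_sub (h : ℕ → ℝ) (h0 : h 0 = 0) (N : ℕ) :
    ∑ n ∈ range N, (2 * (n : ℝ) + 1) * (h (n + 1) - h n) =
      (2 * N + 1) * h N - 2 * ∑ n ∈ range N, h (n + 1) := by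
  induction N with
  | zero => simp [h0]
  | succ N ih =>
    rw [sum_range_succ, sum_range_succ, ih]
    push_cast
    ring

lemma sum_harmonic_mul {p : ℕ} (hp : 0 < p) (N : ℕ) :
    ∑ n ∈ range N, (harmonic (p * (n + 1)) : ℝ) =
      ∑ n ∈ range N, harmonicRemainder (p * (n + 1)) + N * Real.log p +
        Real.log (N.factorial) + N * Real.eulerMascheroniConstant + harmonic N / (2 * p) := by
  have hp' : (0 : ℝ) < p := by exact_mod_cast hp
  induction N with
  | zero => simp
  | succ N ih =>
    have hN : ((N : ℝ) + 1) ≠ 0 := by positivity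
    rw [sum_range_succ, sum_range_succ, ih, Nat.factorial_succ, harmonic_succ N,
      harmonicRemainder]
    push_cast
    rw [Real.log_mul hp'.ne' hN, Real.log_mul hN (by positivity)]
    field_simp
    ring

lemma sum_sum_mul_one_div_sub {p : ℕ} (hp : 0 < p) {N : ℕ} (hN : 0 < N) :
    ∑ n ∈ range N, ∑ j ∈ Ico 1 p,
        (j : ℝ) * (1 / ((p : ℝ) * n + j) - 1 / (p * ((n : ℝ) + 1) - j)) =
      2 * p * ∑ n ∈ range N, harmonicRemainder (p * (n + 1)) +
        p * (2 * Real.log (Stirling.stirlingSeq N) + Real.log 2) - p * Real.log p -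
        p * Real.eulerMascheroniConstant - 1 - 1 / 2 * (1 / (N : ℝ)) -
        p * (2 * N + 1) * harmonicRemainder (p * N) := by
  have hp' : (0 : ℝ) < p := by exact_mod_cast hp
  have hN' : (0 : ℝ) < N := by exact_mod_cast hN
  have hharm : ∑ n ∈ range N, 1 / ((n : ℝ) + 1) = harmonic N := by
    simp [harmonic]
  have habel := sum_odd_mul_sub (fun n => (harmonic (p * n) : ℝ)) (by simp) N
  simp_rw [sum_mul_one_div_sub hp, mul_assoc (p : ℝ)]
  rw [sum_sub_distrib, sum_sub_distrib, ← mul_sum, ← mul_sum, habel, sum_harmonic_mul hp, hharm,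
    Stirling.log_stirlingSeq_formula, Real.log_div hN'.ne' (Real.exp_ne_zero _), Real.log_exp,
    Real.log_mul two_ne_zero hN'.ne', harmonicRemainder]
  push_cast
  rw [Real.log_mul hp'.ne' hN'.ne']
  simp only [sum_const, card_range, nsmul_eq_mul]
  field_simp
  ring

lemma tendsto_mul_harmonicRemainder {p : ℕ} (hp : 0 < p) :
    Tendsto (fun N : ℕ => (p : ℝ) * (2 * N + 1) * harmonicRemainder (p * N)) atTop (𝓝 0) := by
  have hp' : (0 : ℝ) < p := by exact_mod_cast hp
  have hlim := (tendsto_one_div_atTop_nhds_zero_nat (𝕜 := ℝ)).const_mul (3 / p : ℝ)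
  rw [mul_zero] at hlim
  refine squeeze_zero_norm' ?_ hlim
  filter_upwards [eventually_gt_atTop 0] with N hN
  have hN' : (1 : ℝ) ≤ N := by exact_mod_cast hN
  have hb := abs_harmonicRemainder_le (Nat.mul_pos hp hN)
  push_cast at hb
  rw [Real.norm_eq_abs, abs_mul, abs_of_nonneg (by positivity : 0 ≤ (p : ℝ) * (2 * N + 1))]
  calc (p : ℝ) * (2 * N + 1) * |harmonicRemainder (p * N)|
      ≤ p * (3 * N) * (1 / (p * N) ^ 2) := by
        gcongr
        linarith
    _ = 3 / p * (1 / N) := by field_simp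

lemma tendsto_sum_pi_mul_cotSum {p : ℕ} (hp : 0 < p) :
    Tendsto (fun N : ℕ => (p : ℝ) * ∑ n ∈ range N, ∑ j ∈ Ico 1 p,
        (j : ℝ) * (1 / ((p : ℝ) * n + j) - 1 / (p * ((n : ℝ) + 1) - j))) atTop
      (𝓝 (Real.pi * cotSum p)) := by
  have hp' : (0 : ℝ) < p := by exact_mod_cast hp
  have hI : Icc 1 (p - 1) = Ico 1 p := by
    ext j
    simp only [mem_Icc, mem_Ico]
    omega
  have hlim : Tendsto (fun N : ℕ => ∑ j ∈ Ico 1 p, (j : ℝ) *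
      ∑ n ∈ range N, (1 / ((n : ℝ) + j / p) - 1 / ((n : ℝ) + 1 - j / p))) atTop
      (𝓝 (∑ j ∈ Ico 1 p, (j : ℝ) * (Real.pi * Real.cot (Real.pi * (j / p))))) := by
    refine tendsto_finsetSum _ fun j hj => Tendsto.const_mul _ ?_
    rw [mem_Ico] at hj
    have hj0 : (0 : ℝ) < j := by exact_mod_cast hj.1
    have hj1 : (j : ℝ) < p := by exact_mod_cast hj.2
    exact tendsto_sum_pi_mul_cot (by positivity) ((div_lt_one hp').2 hj1)
  convert hlim using 1
  · ext N
    simp_rw [mul_sum]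
    rw [sum_comm]
    refine sum_congr rfl fun j hj => sum_congr rfl fun n _ => ?_
    have h1 : (n : ℝ) + j / p = (p * n + j) / p := by field_simp
    have h2 : (n : ℝ) + 1 - j / p = (p * (n + 1) - j) / p := by field_simp
    rw [h1, h2, one_div_div, one_div_div]
    ring
  · rw [cotSum, hI, mul_sum]
    congr 1
    refine sum_congr rfl fun j _ => ?_
    rw [mul_comm (j : ℝ) Real.pi, mul_div_assoc]
    ring

theorem proposition9p6 (p : ℕ) (hp : 0 < p) :
    Summable (fun n : ℕ => harmonicRemainder (p * (n + 1))) ∧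
      Real.pi * cotSum p =
        -(p : ℝ) ^ 2 * Real.log (p : ℝ)
          + (Real.log (2 * Real.pi) - Real.eulerMascheroniConstant) * (p : ℝ) ^ 2
          - (p : ℝ) + 2 * (p : ℝ) ^ 2 * harmonicRemainderSum p := by
  have hs := summable_harmonicRemainder_mul hp
  refine ⟨hs, tendsto_nhds_unique (tendsto_sum_pi_mul_cotSum hp) ?_⟩
  -- The constant arises as `2 log √π + log 2 = log (2π)`.
  have hst := (Stirling.tendsto_stirlingSeq_sqrt_pi.log (by positivity)).const_mul 2
  have hst' := (hst.add_const (Real.log 2)).const_mul (p : ℝ)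
  have hlim := (((((((hs.hasSum.tendsto_sum_nat).const_mul (2 * (p : ℝ))).add hst').sub_const
    (p * Real.log p)).sub_const (p * Real.eulerMascheroniConstant)).sub_const 1).sub
    ((tendsto_one_div_atTop_nhds_zero_nat (𝕜 := ℝ)).const_mul (1 / 2))).sub
    (tendsto_mul_harmonicRemainder hp)
  have hlim' := (hlim.const_mul (p : ℝ)).congr' (f₂ := fun N : ℕ => (p : ℝ) *
      ∑ n ∈ range N, ∑ j ∈ Ico 1 p,
        (j : ℝ) * (1 / ((p : ℝ) * n + j) - 1 / (p * ((n : ℝ) + 1) - j))) (by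
    filter_upwards [eventually_gt_atTop 0] with N hN
    rw [sum_sum_mul_one_div_sub hp hN])
  convert hlim' using 2
  rw [Real.log_sqrt Real.pi_pos.le, Real.log_mul two_ne_zero Real.pi_ne_zero,
    harmonicRemainderSum]
  ring
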